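/- Let $\mathbb{F}$ be an algebraically closed field of characteristic different from $2$ and let $\mathcal{C}$ be an octonion algebra over $\mathbb{F}$, that is, an $8$-dimensional unital (not necessarily associative) algebra with a multiplicative quadratic form $n$ whose polar form $n(a,b)=n(a+b)-n(a)-n(b)$ is nondegenerate; put $\bar a=n(a,1)1-a$. Let $\mathbb{A}=\mathcal{H}_3(\mathcal{C})$ be the Albert algebra: the $27$-dimensional Jordan algebra of Hermitian $3\times 3$ matrices over $\mathcal{C}$ (with respect to $(x_{ij})\mapsto(\overline{x_{ji}})$) with the product $x\circ y=\frac12(xy+yx)$. Every $x\in\mathbb{A}$ can be written uniquely as $$x=\begin{pmatrix}\alpha_1&2\bar a_3&2a_2\\ 2a_3&\alpha_2&2\bar a_1\\ 2\bar a_2&2a_1&\alpha_3\end{pmatrix},\qquad \alpha_i\in\mathbb{F},\ a_i\in\mathcal{C},$$ and one sets $T(x)=\alpha_1+\alpha_2+\alpha_3$, $S(x)=\frac12\bigl(T(x)^2-T(x\circ x)\bigr)$ and $$N(x)=\alpha_1\alpha_2\alpha_3+8n(a_1,\bar a_2\bar a_3)-4\sum_{i=1}^3\alpha_i n(a_i).$$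 Let $M(\mathbb{A})$ be the group of linear bijections $f:\mathbb{A}\to\mathbb{A}$ for which there is $\lambda\in\mathbb{F}$ with $N(f(x))=\lambda N(x)$ for all $x$, and let $M_1(\mathbb{A})$ be the subgroup of those with $N(f(x))=N(x)$ for all $x$. For $x\in\mathbb{A}$ let $U_x(y)=2x\circ(x\circ y)-(x\circ x)\circ y$, let $\operatorname{rank}(x)=\dim(\operatorname{im}U_x)$, let $\mu_x(X)$ be the minimal polynomial of $x$, and put $\mathcal{O}_k=\{x\in\mathbb{A}\mid\operatorname{rank}(x)=k\}$. Then: 1. The orbits of $M(\mathbb{A})$ on $\mathbb{A}$ are exactly $\mathcal{O}_0=\{0\}$, $\mathcal{O}_1$, $\mathcal{O}_{10}$ and $\mathcal{O}_{27}$. 2. $\mathcal{O}_{27}=\{x\in\mathbb{A}\mid N(x)\neq0\}$. 3. $\mathcal{O}_1$ is the set of all $x\neq0$ with $N(x)=0$, $S(x)=0$ and $\deg\mu_x=2$; moreover $\mu_x(X)=X^2-T(x)X$ for every $x\in\mathcal{O}_1$. 4. The orbits of $M_1(\mathbb{A})$ on $\mathbb{A}$ are exactly $\mathcal{O}_0$,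 $\mathcal{O}_1$, $\mathcal{O}_{10}$ and the sets $\mathcal{O}_{27}(\lambda)=\{x\in\mathcal{O}_{27}\mid N(x)=\lambda\}$, $\lambda\in\mathbb{F}^\times$. -/

import Mathlib

open Polynomial

section AlbertAlgebra

/-- The space of Hermitian `3 × 3` matrices over the octonion algebra `C`
(in characteristic different from `2`). The pair `(α, a)` is the matrix
`∑ i, (α i • E i + ι i (a i))`; with indices `0, 1, 2` this is

  `α 0           2 conj (a 2)   2 a 1`
  `2 a 2         α 1            2 conj (a 0)`
  `2 conj (a 1)  2 a 0          α 2`  -/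
@[ext]
structure Albert (F C : Type*) where
  diag : Fin 3 → F
  off : Fin 3 → C

namespace Albert

variable {F C : Type*}

theorem toProd_injective :
    Function.Injective (fun x : Albert F C => (x.diag, x.off)) := fun x y h => by
  ext1
  · exact congrArg Prod.fst h
  · exact congrArg Prod.snd h

instance {R : Type*} [SMul R F] [SMul R C] : SMul R (Albert F C) :=
  ⟨fun c x => ⟨c • x.diag, c • x.off⟩⟩

@[simp] theorem smul_diag {R : Type*} [SMul R F] [SMul R C] (c : R) (x : Albert F C) :
    (c • x).diag = c • x.diag := rfl
@[simp] theorem smul_off {R : Type*} [SMul R F] [SMul R C] (c : R) (x : Albert F C) :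
    (c • x).off = c • x.off := rfl

variable [Field F] [NonAssocRing C]

instance : Zero (Albert F C) := ⟨⟨0, 0⟩⟩
instance : Add (Albert F C) := ⟨fun x y => ⟨x.diag + y.diag, x.off + y.off⟩⟩
instance : Neg (Albert F C) := ⟨fun x => ⟨-x.diag, -x.off⟩⟩
instance : Sub (Albert F C) := ⟨fun x y => ⟨x.diag - y.diag, x.off - y.off⟩⟩
@[simp] theorem zero_diag : (0 : Albert F C).diag = 0 := rfl
@[simp] theorem zero_off : (0 : Albert F C).off = 0 := rfl
@[simp] theorem add_diag (x y : Albert F C) : (x + y).diag = x.diag + y.diag := rfl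
@[simp] theorem add_off (x y : Albert F C) : (x + y).off = x.off + y.off := rfl
@[simp] theorem neg_diag (x : Albert F C) : (-x).diag = -x.diag := rfl
@[simp] theorem neg_off (x : Albert F C) : (-x).off = -x.off := rfl
@[simp] theorem sub_diag (x y : Albert F C) : (x - y).diag = x.diag - y.diag := rfl
@[simp] theorem sub_off (x y : Albert F C) : (x - y).off = x.off - y.off := rfl

instance : AddCommGroup (Albert F C) :=
  toProd_injective.addCommGroup (fun x : Albert F C => (x.diag, x.off)) rfl (fun _ _ => rfl)
    (fun _ => rfl) (fun _ _ => rfl) (fun _ _ => rfl) (fun _ _ => rfl)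

/-- The identity element `E 0 + E 1 + E 2`. -/
instance : One (Albert F C) := ⟨⟨fun _ => 1, 0⟩⟩

@[simp] theorem one_diag (i : Fin 3) : (1 : Albert F C).diag i = 1 := rfl
@[simp] theorem one_off : (1 : Albert F C).off = 0 := rfl

variable [Module F C]

instance : Module F (Albert F C) :=
  toProd_injective.module F
    (⟨⟨fun x : Albert F C => (x.diag, x.off), rfl⟩, fun _ _ => rfl⟩ :
      Albert F C →+ (Fin 3 → F) × (Fin 3 → C)) (fun _ _ => rfl)

end Albert

variable {F C : Type*} [Field F] [NonAssocRing C] [Module F C]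

/-- `n` makes the unital, not necessarily associative `F`-algebra `C` an octonion algebra:
`C` has dimension `8` and `n` is a multiplicative quadratic form whose polar form
`n(a, b) = n(a + b) - n(a) - n(b)` is nondegenerate. -/
structure IsOctonionNorm (n : QuadraticForm F C) : Prop where
  finrank_eq : Module.finrank F C = 8
  map_mul : ∀ a b : C, n (a * b) = n a * n b
  nondegenerate : ∀ a : C, (∀ b : C, QuadraticMap.polar n a b = 0) → a = 0

/-- The standard involution `a ↦ n(a, 1) 1 - a` of an octonion algebra with norm `n`. -/
def octConj (n : QuadraticForm F C) (a : C) : C :=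
  QuadraticMap.polar n a 1 • (1 : C) - a

namespace Albert

/-- The Jordan product, that is, the symmetrized matrix product `(x y + y x) / 2`. It is the
commutative bilinear product for which the `E i` are orthogonal idempotents and, with indices
modulo `3`, `E i ∘ ι i a = 0`, `E (i+1) ∘ ι i a = E (i+2) ∘ ι i a = (1/2) ι i a`,
`ι i a ∘ ι (i+1) b = ι (i+2) (conj a * conj b)`,
`ι i a ∘ ι i b = 2 n(a, b) (E (i+1) + E (i+2))`. -/
def mul (n : QuadraticForm F C) (x y : Albert F C) : Albert F C where
  diag i := x.diag i * y.diag i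
    + 2 * (QuadraticMap.polar n (x.off (i + 1)) (y.off (i + 1))
      + QuadraticMap.polar n (x.off (i + 2)) (y.off (i + 2)))
  off i := ((x.diag (i + 1) + x.diag (i + 2)) / 2) • y.off i
    + ((y.diag (i + 1) + y.diag (i + 2)) / 2) • x.off i
    + octConj n (x.off (i + 1)) * octConj n (y.off (i + 2))
    + octConj n (y.off (i + 1)) * octConj n (x.off (i + 2))

theorem octConj_add (n : QuadraticForm F C) (a b : C) :
    octConj n (a + b) = octConj n a + octConj n b := by
  simp only [octConj, QuadraticMap.polar_add_left, add_smul]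
  abel

theorem octConj_smul (n : QuadraticForm F C) (c : F) (a : C) :
    octConj n (c • a) = c • octConj n a := by
  simp only [octConj, QuadraticMap.polar_smul_left, smul_eq_mul, mul_smul, smul_sub]

/-- The generic trace. -/
def T (x : Albert F C) : F := x.diag 0 + x.diag 1 + x.diag 2

/-- The quadratic form `S(x) = (T(x)² - T(x²)) / 2`. -/
def S (n : QuadraticForm F C) (x : Albert F C) : F := (T x ^ 2 - T (mul n x x)) / 2

/-- The generic norm. -/
def N (n : QuadraticForm F C) (x : Albert F C) : F :=
  x.diag 0 * x.diag 1 * x.diag 2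
    + 8 * QuadraticMap.polar n (x.off 0) (octConj n (x.off 1) * octConj n (x.off 2))
    - 4 * ∑ i, x.diag i * n (x.off i)

theorem N_one (n : QuadraticForm F C) : N n (1 : Albert F C) = 1 := by
  simp [N, octConj]

/-- The group of norm similarities: linear bijections `f` with `N(f(x)) = c N(x)` for all `x`,
for some multiplier `c`. -/
def normSimilarityGroup (n : QuadraticForm F C) : Subgroup (Albert F C ≃ₗ[F] Albert F C) where
  carrier := {f | ∃ c : F, ∀ x, N n (f x) = c * N n x}
  one_mem' := ⟨1, fun x => by simp⟩
  mul_mem' {f g} := by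
    rintro ⟨c, hc⟩ ⟨d, hd⟩
    exact ⟨c * d, fun x => by rw [LinearEquiv.mul_apply, hc, hd, mul_assoc]⟩
  inv_mem' {f} := by
    rintro ⟨c, hc⟩
    have hc0 : c ≠ 0 := by
      rintro rfl
      have h := hc (f⁻¹ 1)
      rw [← LinearEquiv.mul_apply, mul_inv_cancel] at h
      change N n 1 = _ at h
      rw [N_one, zero_mul] at h
      exact one_ne_zero h
    refine ⟨c⁻¹, fun x => ?_⟩
    have h := hc (f⁻¹ x)
    rw [← LinearEquiv.mul_apply, mul_inv_cancel] at h
    change N n x = _ at h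
    rw [h, inv_mul_cancel_left₀ hc0]

/-- The group of norm isometries: linear bijections `f` with `N(f(x)) = N(x)` for all `x`. -/
def isometryGroup (n : QuadraticForm F C) : Subgroup (Albert F C ≃ₗ[F] Albert F C) where
  carrier := {f | ∀ x, N n (f x) = N n x}
  one_mem' := fun x => by simp
  mul_mem' {f g} hf hg x := by rw [LinearEquiv.mul_apply, hf, hg]
  inv_mem' {f} hf x := by
    have h := hf (f⁻¹ x)
    rw [← LinearEquiv.mul_apply, mul_inv_cancel] at h
    change N n x = _ at h
    exact h.symm

variable [IsScalarTower F C C] [SMulCommClass F C C]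

/-- Left multiplication `L_x : y ↦ x ∘ y`. -/
def L (n : QuadraticForm F C) (x : Albert F C) : Module.End F (Albert F C) where
  toFun := mul n x
  map_add' y z := by
    ext i
    · simp only [mul, add_diag, add_off, Pi.add_apply, QuadraticMap.polar_add_right]
      ring
    · simp only [mul, add_diag, add_off, Pi.add_apply, octConj_add, mul_add, add_mul]
      module
  map_smul' c y := by
    ext i
    · simp only [mul, smul_diag, smul_off, Pi.smul_apply, QuadraticMap.polar_smul_right,
        smul_eq_mul, RingHom.id_apply]
      ring
    · simp only [mul, smul_diag, smul_off, Pi.smul_apply, octConj_smul, mul_smul_comm,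
        smul_mul_assoc, smul_eq_mul, RingHom.id_apply]
      module

/-- The operator `U_x : y ↦ 2 x ∘ (x ∘ y) - x² ∘ y`. -/
def U (n : QuadraticForm F C) (x : Albert F C) : Module.End F (Albert F C) :=
  (2 : F) • (L n x ∘ₗ L n x) - L n (mul n x x)

/-- The rank of `x`: the dimension of the image of `U_x`. -/
noncomputable def rank (n : QuadraticForm F C) (x : Albert F C) : ℕ :=
  Module.finrank F (LinearMap.range (U n x))

/-- `rankSet n k` is the set of elements of rank `k`. -/
def rankSet (n : QuadraticForm F C) (k : ℕ) : Set (Albert F C) := {x | rank n x = k}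

/-- The value `p(x)` of a polynomial `p`, where `x ^ 0 = 1` and `x ^ (k + 1) = x ∘ x ^ k`. -/
noncomputable def evalPoly (n : QuadraticForm F C) (x : Albert F C) (p : F[X]) : Albert F C :=
  aeval (L n x) p 1

/-- The ideal of polynomials vanishing at `x`. -/
def annIdeal (n : QuadraticForm F C) (x : Albert F C) : Ideal F[X] where
  carrier := {p | evalPoly n x p = 0}
  zero_mem' := by simp [evalPoly]
  add_mem' {p q} hp hq := by
    simp only [Set.mem_ofPred_eq, evalPoly] at hp hq ⊢
    simp [hp, hq]
  smul_mem' p q hq := by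
    simp only [Set.mem_ofPred_eq, evalPoly] at hq ⊢
    simp [hq]

/-- The minimal polynomial of `x`: the monic generator of the ideal of polynomials
vanishing at `x`. -/
noncomputable def minPoly (n : QuadraticForm F C) (x : Albert F C) : F[X] :=
  Submodule.IsPrincipal.generator (annIdeal n x) *
    Polynomial.C (Submodule.IsPrincipal.generator (annIdeal n x)).leadingCoeff⁻¹


end Albert

end AlbertAlgebra

/-!
Every element of the Albert algebra can be brought to diagonal form by row and column operations
that preserve the norm, just as for symmetric matrices under congruence; the point is that
these operations still make sense over the nonassociative octonions and that they preserve the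
rank.

The link between norm and rank is the quadratic adjoint `adj x = x² - T(x) x + S(x) 1`. It is the
gradient of the cubic form `N` with respect to the trace form (`Albert.N_add`,
`Albert.two_mul_traceForm_adj`), and `U_x y = T(x, y) x - (adj x) × y`, where `×` is the
linearization of `adj` (`Albert.U_apply`). Hence if `f` and `g` preserve `N` and are inverse
adjoint to each other with respect to the trace form, then `adj (f x) = g (adj x)` and
`U_{f x} ∘ g = f ∘ U_x`, so that `f` preserves the rank (`Albert.IsDualPair.rank_eq`).

Such pairs are provided by the cyclic permutations, by the diagonal matrices of determinant `1`,
and by the elementary matrices `1 + d e₂₁` and their conjugate transposes acting by `x ↦ g x g*`.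
By elimination they carry every element to `0`, `E 0`, `E 0 + E 1` or `E 0 + E 1 + c E 2` with
`c = N x ≠ 0` (`Albert.normEquiv_classification`), and for diagonal elements the operator `U` is
diagonal and its rank is `0`, `1`, `10`, `27` respectively. In particular rank `27` means
`N x ≠ 0`, and rank `1` means `x ≠ 0`, `N x = 0`, `adj x = 0`. An arbitrary norm similarity
preserves the vanishing of `x`, of `N x` and of its gradient `adj x`, so it preserves the rank
(`Albert.rank_apply`); this gives both lists of orbits, a scalar with prescribed cube
accounting for the norm in the case of similarities.

For the minimal polynomial, `x ∘ adj x = N(x) 1` (`Albert.mul_adj`) is the generic cubic equation.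
If `adj x = 0` and `x ≠ 0`, then `x² = T(x) x`. Conversely, if `N x = S x = 0` and `x` satisfies a
quadratic equation, then `adj x` is a combination of `x` and `1`, and `x ∘ adj x = 0` makes its
coefficients vanish.
-/

/-! ### Identities in octonion algebras -/

namespace IsOctonionNorm

variable {F C : Type*} [Field F] [NonAssocRing C] [Module F C] {n : QuadraticForm F C}

theorem eq_of_polar_eq (hn : IsOctonionNorm n) {a b : C}
    (h : ∀ c, QuadraticMap.polar n a c = QuadraticMap.polar n b c) : a = b :=
  sub_eq_zero.mp <| hn.nondegenerate _ fun c => by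
    rw [QuadraticMap.polar_sub_left, h, sub_self]

theorem exists_polar_ne_zero (hn : IsOctonionNorm n) {a : C} (ha : a ≠ 0) :
    ∃ d, QuadraticMap.polar n d a ≠ 0 := by
  by_contra! h
  exact ha (hn.nondegenerate a fun d => by rw [QuadraticMap.polar_comm, h])

theorem map_one (hn : IsOctonionNorm n) : n 1 = 1 := by
  have h := hn.map_mul 1 1
  rw [mul_one] at h
  by_contra h1
  have h0 : n 1 = 0 := by
    by_contra h0
    exact h1 (mul_left_cancel₀ h0 (by rw [← h, mul_one]))
  have hz : ∀ a, n a = 0 := fun a => by simpa [h0] using hn.map_mul 1 a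
  have hsub : Subsingleton C := ⟨fun a b => hn.eq_of_polar_eq fun c => by
    simp [QuadraticMap.polar, hz]⟩
  have := hn.finrank_eq
  rw [Module.finrank_zero_of_subsingleton] at this
  omega

theorem finite (hn : IsOctonionNorm n) : Module.Finite F C :=
  Module.finite_of_finrank_pos (by rw [hn.finrank_eq]; norm_num)

theorem polar_mul_mul_left (hn : IsOctonionNorm n) (a b c : C) :
    QuadraticMap.polar n (a * b) (a * c) = n a * QuadraticMap.polar n b c := by
  simp only [QuadraticMap.polar, ← mul_add, hn.map_mul]
  ring

theorem polar_mul_mul_right (hn : IsOctonionNorm n) (a b c : C) :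
    QuadraticMap.polar n (a * c) (b * c) = QuadraticMap.polar n a b * n c := by
  simp only [QuadraticMap.polar, ← add_mul, hn.map_mul]
  ring

/-- The full linearization of the multiplicativity of the norm. -/
theorem polar_mul_add_polar_mul (hn : IsOctonionNorm n) (a b c d : C) :
    QuadraticMap.polar n (a * b) (c * d) + QuadraticMap.polar n (c * b) (a * d)
      = QuadraticMap.polar n a c * QuadraticMap.polar n b d := by
  have h := hn.polar_mul_mul_left (a + c) b d
  simp only [add_mul, QuadraticMap.polar_add_left, QuadraticMap.polar_add_right,
    QuadraticMap.map_add n, hn.polar_mul_mul_left] at h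
  linear_combination h

/-- Left multiplication by `octConj n a` is the adjoint of left multiplication by `a`. -/
theorem polar_mul_left (hn : IsOctonionNorm n) [IsScalarTower F C C] (a b c : C) :
    QuadraticMap.polar n (a * b) c = QuadraticMap.polar n b (octConj n a * c) := by
  have h := hn.polar_mul_add_polar_mul a b 1 c
  simp only [one_mul] at h
  simp only [octConj, sub_mul, smul_mul_assoc, one_mul, QuadraticMap.polar_sub_right,
    QuadraticMap.polar_smul_right, smul_eq_mul]
  linear_combination h

/-- Right multiplication by `octConj n b` is the adjoint of right multiplication by `b`. -/
theorem polar_mul_right (hn : IsOctonionNorm n) [SMulCommClass F C C] (a b c : C) :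
    QuadraticMap.polar n (a * b) c = QuadraticMap.polar n a (c * octConj n b) := by
  have h := hn.polar_mul_add_polar_mul a b c 1
  simp only [mul_one] at h
  rw [QuadraticMap.polar_comm n (c * b) a] at h
  simp only [octConj, mul_sub, mul_smul_comm, mul_one, QuadraticMap.polar_sub_right,
    QuadraticMap.polar_smul_right, smul_eq_mul]
  linear_combination h

theorem polar_one_one (hn : IsOctonionNorm n) : QuadraticMap.polar n 1 1 = 2 := by
  rw [QuadraticMap.polar_self, hn.map_one, two_nsmul, one_add_one_eq_two]

theorem octConj_octConj (hn : IsOctonionNorm n) (a : C) : octConj n (octConj n a) = a := by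
  simp only [octConj, QuadraticMap.polar_sub_left, QuadraticMap.polar_smul_left, smul_eq_mul,
    hn.polar_one_one]
  module

theorem polar_octConj_octConj (hn : IsOctonionNorm n) (a b : C) :
    QuadraticMap.polar n (octConj n a) (octConj n b) = QuadraticMap.polar n a b := by
  simp only [octConj, QuadraticMap.polar_sub_left, QuadraticMap.polar_smul_left, smul_eq_mul,
    QuadraticMap.polar_sub_right, QuadraticMap.polar_smul_right, hn.polar_one_one]
  rw [QuadraticMap.polar_comm n 1 b]
  ring

theorem map_octConj (hn : IsOctonionNorm n) (a : C) : n (octConj n a) = n a := by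
  rw [octConj, sub_eq_add_neg, QuadraticMap.map_add n, QuadraticMap.map_smul, hn.map_one,
    QuadraticMap.polar_smul_left, QuadraticMap.polar_neg_right, QuadraticMap.map_neg,
    QuadraticMap.polar_comm n 1 a, smul_eq_mul, smul_eq_mul]
  ring

theorem octConj_mul_mul (hn : IsOctonionNorm n) [IsScalarTower F C C] (a b : C) :
    octConj n a * (a * b) = n a • b :=
  hn.eq_of_polar_eq fun c => by
    rw [hn.polar_mul_left, hn.octConj_octConj, hn.polar_mul_mul_left,
      QuadraticMap.polar_smul_left, smul_eq_mul]

theorem mul_mul_octConj (hn : IsOctonionNorm n) [SMulCommClass F C C] (a b : C) :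
    (b * a) * octConj n a = n a • b :=
  hn.eq_of_polar_eq fun c => by
    rw [hn.polar_mul_right, hn.octConj_octConj, hn.polar_mul_mul_right,
      QuadraticMap.polar_smul_left, smul_eq_mul, mul_comm]

/-- Linearization of `octConj_mul_mul`. -/
theorem octConj_mul_mul_add (hn : IsOctonionNorm n) [IsScalarTower F C C] (a b c : C) :
    octConj n a * (b * c) + octConj n b * (a * c) = QuadraticMap.polar n a b • c := by
  have h := hn.octConj_mul_mul (a + b) c
  simp only [add_mul, mul_add, QuadraticMap.map_add n, hn.octConj_mul_mul,
    Albert.octConj_add] at h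
  linear_combination (norm := module) h

/-- Linearization of `mul_mul_octConj`. -/
theorem mul_mul_octConj_add (hn : IsOctonionNorm n) [SMulCommClass F C C] (a b c : C) :
    (c * a) * octConj n b + (c * b) * octConj n a = QuadraticMap.polar n a b • c := by
  have h := hn.mul_mul_octConj (a + b) c
  simp only [add_mul, mul_add, QuadraticMap.map_add n, hn.mul_mul_octConj,
    Albert.octConj_add] at h
  linear_combination (norm := module) h

variable [IsScalarTower F C C] [SMulCommClass F C C]

theorem octConj_mul (hn : IsOctonionNorm n) (a b : C) :
    octConj n (a * b) = octConj n b * octConj n a :=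
  hn.eq_of_polar_eq fun c => by
    rw [← hn.polar_octConj_octConj, hn.octConj_octConj, hn.polar_mul_left, hn.polar_mul_left,
      hn.octConj_octConj, QuadraticMap.polar_comm n (octConj n a), hn.polar_mul_right]

/-- The trilinear form `n(a, conj b * conj c)` is cyclic. -/
theorem polar_octConj_mul_octConj_rotate (hn : IsOctonionNorm n) (a b c : C) :
    QuadraticMap.polar n a (octConj n b * octConj n c)
      = QuadraticMap.polar n b (octConj n c * octConj n a) := by
  rw [QuadraticMap.polar_comm, hn.polar_mul_right, hn.octConj_octConj, ← hn.octConj_mul,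
    ← hn.polar_octConj_octConj, hn.octConj_octConj]

end IsOctonionNorm

namespace Albert

variable {F C : Type*} [Field F] [NonAssocRing C] [Module F C]

theorem octConj_neg (n : QuadraticForm F C) (a : C) : octConj n (-a) = -octConj n a := by
  simp only [octConj, QuadraticMap.polar_neg_left]
  module

theorem octConj_sub (n : QuadraticForm F C) (a b : C) :
    octConj n (a - b) = octConj n a - octConj n b := by
  rw [sub_eq_add_neg, octConj_add, octConj_neg, sub_eq_add_neg]

theorem octConj_zero (n : QuadraticForm F C) : octConj n (0 : C) = 0 := by
  simp [octConj]

end Albert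

/-! ### The trace form and the adjoint -/

namespace Albert

variable {F C : Type*} [Field F] [NonAssocRing C] [Module F C]

theorem sum_fin_three_rotate {M : Type*} [AddCommMonoid M] (f : Fin 3 → M) (i : Fin 3) :
    ∑ j, f j = f i + f (i + 1) + f (i + 2) := by
  rw [Fin.sum_univ_three]
  fin_cases i
  · rfl
  · exact (add_comm (f 0) (f 1 + f 2)).symm ▸ add_assoc (f 0) (f 1) (f 2)
  · change _ = f 2 + f 0 + f 1
    abel

theorem fin_three_add_one_add_one (i : Fin 3) : i + 1 + 1 = i + 2 := by grind
theorem fin_three_add_one_add_two (i : Fin 3) : i + 1 + 2 = i := by grind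
theorem fin_three_add_two_add_one (i : Fin 3) : i + 2 + 1 = i := by grind
theorem fin_three_add_two_add_two (i : Fin 3) : i + 2 + 2 = i + 1 := by grind

/-- The trace form `T(x ∘ y)`, written out. -/
def traceForm (n : QuadraticForm F C) (x y : Albert F C) : F :=
  ∑ i, (x.diag i * y.diag i + 4 * QuadraticMap.polar n (x.off i) (y.off i))

/-- The adjoint `x² - T(x) x + S(x) 1`, written out: the gradient of the norm `N` with respect
to the trace form. -/
def adj (n : QuadraticForm F C) (x : Albert F C) : Albert F C where
  diag i := x.diag (i + 1) * x.diag (i + 2) - 4 * n (x.off i)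
  off i := (2 : F) • (octConj n (x.off (i + 1)) * octConj n (x.off (i + 2)))
    - x.diag i • x.off i

/-- The linearization of `adj`. -/
def cross (n : QuadraticForm F C) (x y : Albert F C) : Albert F C :=
  adj n (x + y) - adj n x - adj n y

theorem traceForm_comm (n : QuadraticForm F C) (x y : Albert F C) :
    traceForm n x y = traceForm n y x := by
  simp only [traceForm, mul_comm (x.diag _), QuadraticMap.polar_comm n (x.off _)]

theorem traceForm_sub_left (n : QuadraticForm F C) (x y z : Albert F C) :
    traceForm n (x - y) z = traceForm n x z - traceForm n y z := by
  simp only [traceForm, sub_diag, sub_off, Pi.sub_apply, QuadraticMap.polar_sub_left,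
    ← Finset.sum_sub_distrib]
  exact Finset.sum_congr rfl fun i _ => by ring

theorem eq_zero_of_traceForm_eq_zero {n : QuadraticForm F C} (hn : IsOctonionNorm n)
    (h2 : (2 : F) ≠ 0) {x : Albert F C} (h : ∀ y, traceForm n x y = 0) : x = 0 := by
  have h4 : (4 : F) ≠ 0 := by
    rw [show (4 : F) = 2 * 2 by norm_num]
    exact mul_ne_zero h2 h2
  ext i
  · have := h ⟨Pi.single i 1, 0⟩
    simpa [traceForm, Pi.single_apply] using this
  · refine hn.nondegenerate _ fun b => ?_
    have := h ⟨0, Pi.single i b⟩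
    rw [traceForm, Finset.sum_eq_single i] at this
    · simpa [h4] using this
    · intro j _ hj
      simp [hj]
    · simp

section Identities

/-- The definition of the adjoint, `adj x = x² - T(x) x + S(x) 1`, solved for `x²`. -/
theorem mul_self_eq (n : QuadraticForm F C) (h2 : (2 : F) ≠ 0) (x : Albert F C) :
    mul n x x = adj n x + T x • x - S n x • 1 := by
  have hT : T x = ∑ i, x.diag i := by rw [T, Fin.sum_univ_three]
  have hT' : T (mul n x x) = ∑ i, (mul n x x).diag i := by rw [T, Fin.sum_univ_three]
  ext i
  · simp only [S, hT, hT', sum_fin_three_rotate _ i]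
    simp only [mul, adj, fin_three_add_one_add_one, fin_three_add_one_add_two,
      fin_three_add_two_add_one, fin_three_add_two_add_two, add_diag, sub_diag, smul_diag,
      Pi.add_apply, Pi.sub_apply, Pi.smul_apply, one_diag, smul_eq_mul, QuadraticMap.polar_self,
      nsmul_eq_mul, Nat.cast_ofNat]
    field_simp
    ring
  · simp only [hT, sum_fin_three_rotate _ i]
    simp only [mul, adj, add_off, sub_off, smul_off, Pi.add_apply, Pi.sub_apply, Pi.smul_apply,
      one_off, Pi.zero_apply]
    match_scalars <;> field_simp <;> ring

theorem cross_diag (n : QuadraticForm F C) (x y : Albert F C) (i : Fin 3) :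
    (cross n x y).diag i = x.diag (i + 1) * y.diag (i + 2) + y.diag (i + 1) * x.diag (i + 2)
      - 4 * QuadraticMap.polar n (x.off i) (y.off i) := by
  simp only [cross, adj, sub_diag, add_diag, add_off, Pi.add_apply, Pi.sub_apply,
    QuadraticMap.map_add n]
  ring

theorem cross_off (n : QuadraticForm F C) (x y : Albert F C) (i : Fin 3) :
    (cross n x y).off i = (2 : F) • (octConj n (x.off (i + 1)) * octConj n (y.off (i + 2))
      + octConj n (y.off (i + 1)) * octConj n (x.off (i + 2)))
      - (x.diag i • y.off i + y.diag i • x.off i) := by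
  simp only [cross, adj, sub_off, add_diag, add_off, Pi.add_apply, Pi.sub_apply,
    octConj_add, add_mul, mul_add]
  module

variable [IsScalarTower F C C] [SMulCommClass F C C]

/-- The norm with the indices cyclically shifted. -/
theorem N_eq_rotate {n : QuadraticForm F C} (hn : IsOctonionNorm n) (x : Albert F C)
    (i : Fin 3) : N n x = x.diag i * x.diag (i + 1) * x.diag (i + 2)
      + 8 * QuadraticMap.polar n (x.off i)
        (octConj n (x.off (i + 1)) * octConj n (x.off (i + 2)))
      - 4 * (x.diag i * n (x.off i) + x.diag (i + 1) * n (x.off (i + 1))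
        + x.diag (i + 2) * n (x.off (i + 2))) := by
  have hr := hn.polar_octConj_mul_octConj_rotate
  rw [N, sum_fin_three_rotate _ i]
  fin_cases i
  · rfl
  · rw [hr]; simp; ring
  · rw [hr, hr]; simp; ring

/-- The generic cubic equation of `x`, written as `x ∘ adj x = N(x) 1`. -/
theorem mul_adj {n : QuadraticForm F C} (hn : IsOctonionNorm n) (h2 : (2 : F) ≠ 0)
    (x : Albert F C) : mul n x (adj n x) = N n x • 1 := by
  have hr := hn.polar_octConj_mul_octConj_rotate
  ext i
  · rw [smul_diag, Pi.smul_apply, one_diag, N_eq_rotate hn x i]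
    simp only [mul, adj, fin_three_add_one_add_one, fin_three_add_one_add_two,
      fin_three_add_two_add_one, fin_three_add_two_add_two, QuadraticMap.polar_sub_right,
      QuadraticMap.polar_smul_right, QuadraticMap.polar_self, smul_eq_mul, nsmul_eq_mul,
      Nat.cast_ofNat]
    rw [hr (x.off i), hr (x.off (i + 1)) (x.off (i + 2)) (x.off i)]
    ring
  · simp only [mul, adj, fin_three_add_one_add_one, fin_three_add_one_add_two,
      fin_three_add_two_add_one, fin_three_add_two_add_two, smul_off, one_off, Pi.smul_apply,
      Pi.zero_apply, smul_zero, octConj_sub, octConj_smul, hn.octConj_mul, hn.octConj_octConj,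
      mul_sub, sub_mul, mul_smul_comm, smul_mul_assoc, hn.octConj_mul_mul, hn.mul_mul_octConj]
    match_scalars <;> field_simp <;> ring

/-- The Taylor expansion of the norm; `adj` is its gradient. -/
theorem N_add {n : QuadraticForm F C} (hn : IsOctonionNorm n) (x y : Albert F C) :
    N n (x + y) = N n x + traceForm n (adj n x) y + traceForm n x (adj n y) + N n y := by
  have hr := hn.polar_octConj_mul_octConj_rotate
  have hc (a b c : C) : QuadraticMap.polar n (octConj n b * octConj n c) a
      = QuadraticMap.polar n a (octConj n b * octConj n c) := QuadraticMap.polar_comm n _ _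
  simp only [N_eq_rotate hn _ 0, traceForm, sum_fin_three_rotate _ 0, adj]
  simp only [zero_add, add_diag, add_off, Pi.add_apply,
    octConj_add, QuadraticMap.polar_add_left, QuadraticMap.polar_add_right, mul_add, add_mul,
    QuadraticMap.polar_sub_left, QuadraticMap.polar_sub_right, QuadraticMap.polar_smul_left,
    QuadraticMap.polar_smul_right, smul_eq_mul, QuadraticMap.map_add n, hc, Fin.isValue,
    Fin.reduceAdd]
  -- rotate every trilinear term until its first argument has index `0`
  simp only [hr (x.off 1), hr (y.off 1), hr (x.off 2), hr (y.off 2)]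
  ring

/-- The operator `U_x` in terms of the trace form and the adjoint; a map that is compatible
with both of these is therefore compatible with the rank. -/
theorem U_apply {n : QuadraticForm F C} (hn : IsOctonionNorm n) (h2 : (2 : F) ≠ 0)
    (x y : Albert F C) :
    U n x y = traceForm n x y • x - cross n (adj n x) y := by
  have hr := hn.polar_octConj_mul_octConj_rotate
  have hU : U n x y = (2 : F) • mul n x (mul n x y) - mul n (mul n x x) y := rfl
  rw [hU]
  ext i
  · simp only [traceForm, sum_fin_three_rotate _ i, smul_diag, sub_diag, Pi.smul_apply,
      Pi.sub_apply, cross_diag]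
    simp only [mul, adj, fin_three_add_one_add_one, fin_three_add_one_add_two,
      fin_three_add_two_add_one, fin_three_add_two_add_two, smul_eq_mul,
      QuadraticMap.polar_add_left, QuadraticMap.polar_add_right, QuadraticMap.polar_sub_left,
      QuadraticMap.polar_smul_left, QuadraticMap.polar_smul_right]
    have hc (a b c : C) : QuadraticMap.polar n (octConj n b * octConj n c) a
      = QuadraticMap.polar n a (octConj n b * octConj n c) := QuadraticMap.polar_comm n _ _
    -- rotate every trilinear term until its first argument has index `i`
    simp only [hc, hr (x.off (i + 1)), hr (x.off (i + 2)), hr (y.off (i + 1)), hr (y.off (i + 2)),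
      QuadraticMap.polar_self, nsmul_eq_mul, Nat.cast_ofNat]
    field_simp
    ring
  · simp only [traceForm, sum_fin_three_rotate _ i, smul_off, sub_off, Pi.smul_apply,
      Pi.sub_apply, cross_off]
    simp only [mul, adj, fin_three_add_one_add_one, fin_three_add_one_add_two,
      fin_three_add_two_add_one, fin_three_add_two_add_two, octConj_add, octConj_sub,
      octConj_smul, hn.octConj_mul, hn.octConj_octConj, mul_add, add_mul,
      mul_sub, sub_mul, mul_smul_comm, smul_mul_assoc, hn.octConj_mul_mul, hn.mul_mul_octConj,
      QuadraticMap.polar_self, nsmul_eq_mul, Nat.cast_ofNat]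
    -- the remaining octonion products cancel by linearized alternativity
    have e1 := hn.octConj_mul_mul_add (x.off (i + 1)) (y.off (i + 1)) (x.off i)
    have e2 := hn.mul_mul_octConj_add (x.off (i + 2)) (y.off (i + 2)) (x.off i)
    linear_combination (norm := skip) (2 : F) • e1 + (2 : F) • e2
    match_scalars <;> field_simp <;> ring

end Identities

end Albert

/-! ### Norm-preserving transformations and the rank -/

namespace Albert

variable {F C : Type*} [Field F] [NonAssocRing C] [Module F C]

/-- The linear equivalence with the underlying product. -/
def equivProd : Albert F C ≃ₗ[F] (Fin 3 → F) × (Fin 3 → C) where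
  toFun x := (x.diag, x.off)
  invFun p := ⟨p.1, p.2⟩
  map_add' _ _ := rfl
  map_smul' _ _ := rfl

theorem module_finite {n : QuadraticForm F C} (hn : IsOctonionNorm n) :
    Module.Finite F (Albert F C) :=
  have := hn.finite
  Module.Finite.equiv equivProd.symm

theorem finrank_eq {n : QuadraticForm F C} (hn : IsOctonionNorm n) :
    Module.finrank F (Albert F C) = 27 := by
  have := hn.finite
  rw [equivProd.finrank_eq, Module.finrank_prod, Module.finrank_pi, Module.finrank_pi_fintype]
  simp [hn.finrank_eq]

/-- The cyclic permutation of rows and columns. -/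
def rotate : Module.End F (Albert F C) where
  toFun x := ⟨fun i => x.diag (i + 1), fun i => x.off (i + 1)⟩
  map_add' _ _ := rfl
  map_smul' _ _ := rfl

variable [IsScalarTower F C C] [SMulCommClass F C C]

/-- The adjoint is determined by the values of the norm. -/
theorem two_mul_traceForm_adj {n : QuadraticForm F C} (hn : IsOctonionNorm n)
    (x y : Albert F C) :
    2 * traceForm n (adj n x) y = N n (x + y) - N n (x - y) - 2 * N n y := by
  have hN : N n (-y) = -N n y := by
    simp only [N, neg_diag, neg_off, Pi.neg_apply, octConj_neg, mul_neg, neg_neg,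
      QuadraticMap.polar_neg_left, QuadraticMap.map_neg, neg_mul, Finset.sum_neg_distrib]
    ring
  have ha : adj n (-y) = adj n y := by
    ext i
    · simp [adj]
    · simp [adj, octConj_neg]
  have ht : traceForm n (adj n x) (-y) = -traceForm n (adj n x) y := by
    rw [← zero_sub, traceForm_comm, traceForm_sub_left, traceForm_comm n y]
    simp [traceForm]
  rw [sub_eq_add_neg x y, N_add hn, N_add hn, hN, ha, ht]
  ring

/-- A pair of linear maps that preserve the norm and are inverse adjoint to each other
with respect to the trace form. -/
structure IsDualPair (n : QuadraticForm F C) (f g : Module.End F (Albert F C)) : Prop where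
  N_left : ∀ x, N n (f x) = N n x
  N_right : ∀ x, N n (g x) = N n x
  traceForm_eq : ∀ x y, traceForm n (f x) (g y) = traceForm n x y

namespace IsDualPair

variable {n : QuadraticForm F C} {f g f' g' : Module.End F (Albert F C)}

omit [IsScalarTower F C C] [SMulCommClass F C C]

theorem symm (h : IsDualPair n f g) : IsDualPair n g f :=
  ⟨h.N_right, h.N_left, fun x y => by rw [traceForm_comm, h.traceForm_eq, traceForm_comm]⟩

theorem comp (h : IsDualPair n f g) (h' : IsDualPair n f' g') :
    IsDualPair n (f' ∘ₗ f) (g' ∘ₗ g) :=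
  ⟨fun x => (h'.N_left _).trans (h.N_left x), fun x => (h'.N_right _).trans (h.N_right x),
    fun x y => (h'.traceForm_eq _ _).trans (h.traceForm_eq x y)⟩

theorem injective (h : IsDualPair n f g) (hn : IsOctonionNorm n) (h2 : (2 : F) ≠ 0) :
    Function.Injective f :=
  (injective_iff_map_eq_zero f).mpr fun x hx => eq_zero_of_traceForm_eq_zero hn h2 fun y => by
    rw [← h.traceForm_eq, hx]
    simp [traceForm]

theorem surjective (h : IsDualPair n f g) (hn : IsOctonionNorm n) (h2 : (2 : F) ≠ 0) :
    Function.Surjective f :=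
  have := module_finite hn
  LinearMap.surjective_of_injective (h.injective hn h2)

variable [IsScalarTower F C C] [SMulCommClass F C C]

theorem adj_eq (h : IsDualPair n f g) (hn : IsOctonionNorm n) (h2 : (2 : F) ≠ 0)
    (x : Albert F C) : adj n (f x) = g (adj n x) := by
  refine sub_eq_zero.mp (eq_zero_of_traceForm_eq_zero hn h2 fun z => ?_)
  obtain ⟨y, rfl⟩ := h.surjective hn h2 z
  have h1 := two_mul_traceForm_adj hn (f x) (f y)
  rw [← map_add, ← map_sub, h.N_left, h.N_left, h.N_left, ← two_mul_traceForm_adj hn] at h1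
  rw [traceForm_sub_left, mul_left_cancel₀ h2 h1, h.symm.traceForm_eq, sub_self]

theorem cross_eq (h : IsDualPair n f g) (hn : IsOctonionNorm n) (h2 : (2 : F) ≠ 0)
    (x y : Albert F C) : cross n (f x) (f y) = g (cross n x y) := by
  simp only [cross, ← map_add, h.adj_eq hn h2, ← map_sub]

theorem U_eq (h : IsDualPair n f g) (hn : IsOctonionNorm n) (h2 : (2 : F) ≠ 0)
    (x y : Albert F C) : U n (f x) (g y) = f (U n x y) := by
  rw [U_apply hn h2, U_apply hn h2, h.traceForm_eq, h.adj_eq hn h2, h.symm.cross_eq hn h2,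
    map_sub, map_smul]

theorem rank_eq (h : IsDualPair n f g) (hn : IsOctonionNorm n) (h2 : (2 : F) ≠ 0)
    (x : Albert F C) : rank n (f x) = rank n x := by
  have hU : U n (f x) ∘ₗ g = f ∘ₗ U n x := LinearMap.ext (h.U_eq hn h2 x)
  -- `g` is surjective and `f` is injective, so they do not change the dimension of the image
  have hr := congrArg LinearMap.range hU
  rw [LinearMap.range_comp_of_range_eq_top _
    (LinearMap.range_eq_top.mpr (h.symm.surjective hn h2)), LinearMap.range_comp] at hr
  rw [rank, hr, rank]
  have := module_finite hn
  exact (LinearEquiv.ofInjectiveEndo f (h.injective hn h2)).finrank_map_eq _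

end IsDualPair

section Transformations

/-- The transformation `x ↦ D x D`, where `D` is diagonal with entries `s`. -/
def scale (s : Fin 3 → F) : Module.End F (Albert F C) where
  toFun x := ⟨fun i => s i ^ 2 * x.diag i, fun i => (s (i + 1) * s (i + 2)) • x.off i⟩
  map_add' x y := by
    ext i
    · simp [mul_add]
    · simp
  map_smul' c x := by
    ext i
    · simp only [smul_diag, Pi.smul_apply, smul_eq_mul, RingHom.id_apply]
      ring
    · simp only [smul_off, Pi.smul_apply, RingHom.id_apply]
      module

/-- The transformation `x ↦ g x g*`, where `g` is the identity matrix with the additional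
entry `conj d` in the first row and second column. -/
def upper (n : QuadraticForm F C) (d : C) : Module.End F (Albert F C) where
  toFun x :=
    ⟨![x.diag 0 + 2 * QuadraticMap.polar n d (x.off 2) + n d * x.diag 1, x.diag 1, x.diag 2],
      ![x.off 0, x.off 1 + octConj n d * octConj n (x.off 0), x.off 2 + (x.diag 1 / 2) • d]⟩
  map_add' x y := by
    ext i <;> fin_cases i <;>
      simp only [add_diag, add_off, Pi.add_apply, QuadraticMap.polar_add_right, octConj_add,
        mul_add, Fin.zero_eta, Fin.mk_one, Fin.reduceFinMk, Matrix.cons_val]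
    · ring
    · abel
    · module
  map_smul' c x := by
    ext i <;> fin_cases i <;>
      simp only [smul_diag, smul_off, Pi.smul_apply, QuadraticMap.polar_smul_right, octConj_smul,
        mul_smul_comm, Fin.zero_eta, Fin.mk_one, Fin.reduceFinMk, Matrix.cons_val,
        RingHom.id_apply, smul_eq_mul]
    · ring
    · module
    · module

/-- The transformation `x ↦ g x g*`, where `g` is the identity matrix with the additional
entry `d` in the second row and first column. -/
def lower (n : QuadraticForm F C) (d : C) : Module.End F (Albert F C) where
  toFun x :=
    ⟨![x.diag 0, x.diag 1 + 2 * QuadraticMap.polar n d (x.off 2) + n d * x.diag 0, x.diag 2],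
      ![x.off 0 + octConj n (x.off 1) * octConj n d, x.off 1, x.off 2 + (x.diag 0 / 2) • d]⟩
  map_add' x y := by
    ext i <;> fin_cases i <;>
      simp only [add_diag, add_off, Pi.add_apply, QuadraticMap.polar_add_right, octConj_add,
        mul_add, add_mul, Fin.zero_eta, Fin.mk_one, Fin.reduceFinMk, Matrix.cons_val]
    · ring
    · abel
    · module
  map_smul' c x := by
    ext i <;> fin_cases i <;>
      simp only [smul_diag, smul_off, Pi.smul_apply, QuadraticMap.polar_smul_right, octConj_smul,
        smul_mul_assoc, Fin.zero_eta, Fin.mk_one, Fin.reduceFinMk, Matrix.cons_val,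
        RingHom.id_apply, smul_eq_mul]
    · ring
    · module
    · module

variable {n : QuadraticForm F C}

theorem isDualPair_rotate (hn : IsOctonionNorm n) :
    IsDualPair n rotate rotate := by
  have hN (x : Albert F C) : N n (rotate x) = N n x := by
    rw [N_eq_rotate hn (rotate x) 0, N_eq_rotate hn x 1]
    rfl
  exact ⟨hN, hN, fun x y => Equiv.sum_comp (Equiv.addRight (1 : Fin 3)) fun i =>
    x.diag i * y.diag i + 4 * QuadraticMap.polar n (x.off i) (y.off i)⟩

theorem N_scale {s : Fin 3 → F} (hs : s 0 * s 1 * s 2 = 1) (x : Albert F C) :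
    N n (scale s x) = N n x := by
  have h1 : (s 0 * s 1 * s 2) ^ 2 = 1 := by rw [hs, one_pow]
  simp only [N, scale, LinearMap.coe_mk, AddHom.coe_mk, octConj_smul, mul_smul_comm,
    smul_mul_assoc, QuadraticMap.polar_smul_left, QuadraticMap.polar_smul_right, smul_eq_mul,
    Fin.sum_univ_three, QuadraticMap.map_smul, Fin.isValue, Fin.reduceAdd, zero_add]
  linear_combination (x.diag 0 * x.diag 1 * x.diag 2
    + 8 * QuadraticMap.polar n (x.off 0) (octConj n (x.off 1) * octConj n (x.off 2))
    - 4 * (x.diag 0 * n (x.off 0) + x.diag 1 * n (x.off 1) + x.diag 2 * n (x.off 2))) * h1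

theorem isDualPair_scale {s t : Fin 3 → F} (hs : s 0 * s 1 * s 2 = 1) (hst : ∀ i, s i * t i = 1) :
    IsDualPair n (scale s) (scale t) := by
  have ht : t 0 * t 1 * t 2 = 1 := by
    have h := congrArg₂ (· * ·) (congrArg₂ (· * ·) (hst 0) (hst 1)) (hst 2)
    simp only [mul_one] at h
    linear_combination h - t 0 * t 1 * t 2 * hs
  refine ⟨N_scale hs, N_scale ht, fun x y => Finset.sum_congr rfl fun i _ => ?_⟩
  simp only [scale, LinearMap.coe_mk, AddHom.coe_mk, QuadraticMap.polar_smul_left,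
    QuadraticMap.polar_smul_right, smul_eq_mul]
  linear_combination x.diag i * y.diag i * (s i * t i + 1) * hst i
    + 4 * QuadraticMap.polar n (x.off i) (y.off i)
      * (s (i + 2) * t (i + 2) * hst (i + 1) + hst (i + 2))

theorem N_upper (hn : IsOctonionNorm n) (h2 : (2 : F) ≠ 0) (d : C) (x : Albert F C) :
    N n (upper n d x) = N n x := by
  have hr := hn.polar_octConj_mul_octConj_rotate
  have h1 : QuadraticMap.polar n (x.off 0) (x.off 0 * d * octConj n (x.off 2))
      = n (x.off 0) * QuadraticMap.polar n d (x.off 2) := by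
    rw [QuadraticMap.polar_comm, hn.polar_mul_right, hn.octConj_octConj, hn.polar_mul_mul_left]
  simp only [N, upper, LinearMap.coe_mk, AddHom.coe_mk, Fin.sum_univ_three, Matrix.cons_val,
    octConj_add, octConj_smul, hn.octConj_mul, hn.octConj_octConj, mul_add, add_mul,
    mul_smul_comm, hn.mul_mul_octConj, QuadraticMap.polar_add_right,
    QuadraticMap.polar_smul_right, h1, QuadraticMap.map_add n, QuadraticMap.map_smul,
    hn.map_mul, hn.map_octConj, hr (x.off 1), hr d, QuadraticMap.polar_self, nsmul_eq_mul,
    Nat.cast_ofNat, smul_eq_mul, QuadraticMap.polar_comm n (x.off 2) d]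
  field_simp
  ring

theorem N_lower (hn : IsOctonionNorm n) (h2 : (2 : F) ≠ 0) (d : C) (x : Albert F C) :
    N n (lower n d x) = N n x := by
  have hr := hn.polar_octConj_mul_octConj_rotate
  have h1 : QuadraticMap.polar n (octConj n (x.off 1) * octConj n d)
      (octConj n (x.off 1) * octConj n (x.off 2))
      = n (x.off 1) * QuadraticMap.polar n d (x.off 2) := by
    rw [hn.polar_mul_mul_left, hn.map_octConj, hn.polar_octConj_octConj]
  have h3 : QuadraticMap.polar n (octConj n (x.off 1) * octConj n d)
      (octConj n (x.off 1) * octConj n d) = 2 * (n (x.off 1) * n d) := by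
    simp only [QuadraticMap.polar_self, hn.map_mul, hn.map_octConj, nsmul_eq_mul, Nat.cast_ofNat]
  simp only [N, lower, LinearMap.coe_mk, AddHom.coe_mk, Fin.sum_univ_three, Matrix.cons_val,
    octConj_add, octConj_smul, mul_add,
    mul_smul_comm, QuadraticMap.polar_add_right, QuadraticMap.polar_add_left,
    QuadraticMap.polar_smul_right, h1, h3, QuadraticMap.map_add n, QuadraticMap.map_smul,
    hn.map_mul, hn.map_octConj, smul_eq_mul, QuadraticMap.polar_comm n (x.off 2) d]
  field_simp
  ring

/-- The inverse adjoint of `upper n d` is `lower n (-d)`, as `lower n d` is the adjoint of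
`upper n d`. -/
theorem isDualPair_upper_lower (hn : IsOctonionNorm n) (h2 : (2 : F) ≠ 0) (d : C) :
    IsDualPair n (upper n d) (lower n (-d)) := by
  have hr := hn.polar_octConj_mul_octConj_rotate
  refine ⟨N_upper hn h2 d, N_lower hn h2 (-d), fun x y => ?_⟩
  have h1 : QuadraticMap.polar n (octConj n d * octConj n (x.off 0)) (y.off 1)
      = QuadraticMap.polar n (x.off 0) (octConj n (y.off 1) * octConj n d) := by
    rw [QuadraticMap.polar_comm, hr, hr]
  simp only [traceForm, upper, lower, LinearMap.coe_mk, AddHom.coe_mk, Fin.sum_univ_three,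
    Matrix.cons_val, octConj_neg, mul_neg, QuadraticMap.polar_add_left, h1,
    QuadraticMap.polar_add_right, QuadraticMap.polar_smul_left, QuadraticMap.polar_smul_right,
    QuadraticMap.polar_neg_left, QuadraticMap.polar_neg_right, QuadraticMap.map_neg,
    QuadraticMap.polar_self, nsmul_eq_mul, Nat.cast_ofNat, smul_neg, smul_eq_mul,
    QuadraticMap.polar_comm n (x.off 2) d]
  field_simp
  ring

end Transformations

end Albert

/-! ### Reduction to diagonal form -/

namespace Albert

variable {F C : Type*} [Field F] [NonAssocRing C] [Module F C]

/-- `y` is the image of `x` under a norm-preserving linear map that has a norm-preserving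
inverse adjoint. -/
def NormEquiv (n : QuadraticForm F C) (x y : Albert F C) : Prop :=
  ∃ f g, IsDualPair n f g ∧ f x = y

variable {n : QuadraticForm F C}

namespace NormEquiv

theorem trans {x y z : Albert F C} (h : NormEquiv n x y) (h' : NormEquiv n y z) :
    NormEquiv n x z := by
  obtain ⟨f, g, hfg, rfl⟩ := h
  obtain ⟨f', g', hfg', rfl⟩ := h'
  exact ⟨_, _, hfg.comp hfg', rfl⟩

theorem refl (x : Albert F C) : NormEquiv n x x :=
  ⟨LinearMap.id, LinearMap.id, ⟨fun _ => rfl, fun _ => rfl, fun _ _ => rfl⟩, rfl⟩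

theorem N_eq {x y : Albert F C} (h : NormEquiv n x y) : N n y = N n x := by
  obtain ⟨f, g, hfg, rfl⟩ := h
  exact hfg.N_left x

theorem mem_orbit {x y : Albert F C} (h : NormEquiv n x y) (hn : IsOctonionNorm n)
    (h2 : (2 : F) ≠ 0) : y ∈ MulAction.orbit (isometryGroup n) x := by
  obtain ⟨f, g, hfg, rfl⟩ := h
  have := module_finite hn
  exact ⟨⟨LinearEquiv.ofInjectiveEndo f (hfg.injective hn h2), hfg.N_left⟩, rfl⟩

variable [IsScalarTower F C C] [SMulCommClass F C C]

theorem rank_eq {x y : Albert F C} (h : NormEquiv n x y) (hn : IsOctonionNorm n)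
    (h2 : (2 : F) ≠ 0) : rank n y = rank n x := by
  obtain ⟨f, g, hfg, rfl⟩ := h
  exact hfg.rank_eq hn h2 x

theorem adj_eq_zero_iff {x y : Albert F C} (h : NormEquiv n x y) (hn : IsOctonionNorm n)
    (h2 : (2 : F) ≠ 0) : adj n y = 0 ↔ adj n x = 0 := by
  obtain ⟨f, g, hfg, rfl⟩ := h
  rw [hfg.adj_eq hn h2, map_eq_zero_iff _ (hfg.symm.injective hn h2)]

end NormEquiv

section Reduction

variable [IsScalarTower F C C] [SMulCommClass F C C]

theorem normEquiv_rotate (hn : IsOctonionNorm n) (p q r : F) (a b c : C) :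
    NormEquiv n ⟨![p, q, r], ![a, b, c]⟩ ⟨![q, r, p], ![b, c, a]⟩ := by
  refine ⟨_, _, isDualPair_rotate hn, ?_⟩
  ext i <;> fin_cases i <;> rfl

theorem normEquiv_upper (hn : IsOctonionNorm n) (h2 : (2 : F) ≠ 0) (d : C) (p q r : F)
    (a b c : C) : NormEquiv n ⟨![p, q, r], ![a, b, c]⟩
      ⟨![p + 2 * QuadraticMap.polar n d c + n d * q, q, r],
        ![a, b + octConj n d * octConj n a, c + (q / 2) • d]⟩ :=
  ⟨_, _, isDualPair_upper_lower hn h2 d, rfl⟩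

theorem normEquiv_lower (hn : IsOctonionNorm n) (h2 : (2 : F) ≠ 0) (d : C) (p q r : F)
    (a b c : C) : NormEquiv n ⟨![p, q, r], ![a, b, c]⟩
      ⟨![p, q + 2 * QuadraticMap.polar n d c + n d * p, r],
        ![a + octConj n b * octConj n d, b, c + (p / 2) • d]⟩ := by
  have h := (isDualPair_upper_lower hn h2 (-d)).symm
  rw [neg_neg] at h
  exact ⟨_, _, h, rfl⟩

/-- If the middle diagonal entry is nonzero, the last off-diagonal entry can be cleared. -/
theorem exists_normEquiv_upper (hn : IsOctonionNorm n) (h2 : (2 : F) ≠ 0) {q : F} (hq : q ≠ 0)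
    (p r : F) (a b c : C) : ∃ p' d, NormEquiv n ⟨![p, q, r], ![a, b, c]⟩
      ⟨![p', q, r], ![a, b + octConj n d * octConj n a, 0]⟩ := by
  have h := normEquiv_upper hn h2 (-(2 / q) • c) p q r a b c
  rw [show c + (q / 2) • -(2 / q) • c = 0 by match_scalars; field_simp; ring] at h
  exact ⟨_, _, h⟩

/-- If the first diagonal entry is nonzero, the last off-diagonal entry can be cleared. -/
theorem exists_normEquiv_lower (hn : IsOctonionNorm n) (h2 : (2 : F) ≠ 0) {p : F} (hp : p ≠ 0)
    (q r : F) (a b c : C) : ∃ q' d, NormEquiv n ⟨![p, q, r], ![a, b, c]⟩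
      ⟨![p, q', r], ![a + octConj n b * octConj n d, b, 0]⟩ := by
  have h := normEquiv_lower hn h2 (-(2 / p) • c) p q r a b c
  rw [show c + (p / 2) • -(2 / p) • c = 0 by match_scalars; field_simp; ring] at h
  exact ⟨_, _, h⟩

/-- A nonzero element can be given a nonzero first diagonal entry. -/
theorem exists_normEquiv_diag_ne_zero (hn : IsOctonionNorm n) (h2 : (2 : F) ≠ 0)
    {x : Albert F C} (hx : x ≠ 0) : ∃ (p q r : F) (a b c : C), p ≠ 0 ∧
      NormEquiv n x ⟨![p, q, r], ![a, b, c]⟩ := by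
  -- up to a cyclic permutation, the first diagonal or the last off-diagonal entry is nonzero
  have key (p q r : F) (a b c : C) (h : p ≠ 0 ∨ c ≠ 0) : ∃ (p' q' r' : F) (a' b' c' : C),
      p' ≠ 0 ∧ NormEquiv n ⟨![p, q, r], ![a, b, c]⟩ ⟨![p', q', r'], ![a', b', c']⟩ := by
    by_cases hp : p = 0
    · by_cases hq : q = 0
      · subst hp hq
        obtain ⟨d, hd⟩ := hn.exists_polar_ne_zero (h.resolve_left (not_not.mpr rfl))
        refine ⟨_, _, _, _, _, _, ?_, normEquiv_upper hn h2 d _ _ _ _ _ _⟩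
        simp [h2, hd]
      · exact ⟨_, _, _, _, _, _, hq, normEquiv_rotate hn _ _ _ _ _ _⟩
    · exact ⟨_, _, _, _, _, _, hp, NormEquiv.refl _⟩
  obtain ⟨v, w⟩ := x
  have hv : v = ![v 0, v 1, v 2] := by ext i; fin_cases i <;> rfl
  have hw : w = ![w 0, w 1, w 2] := by ext i; fin_cases i <;> rfl
  rw [hv, hw]
  have rot := normEquiv_rotate hn (v 0) (v 1) (v 2) (w 0) (w 1) (w 2)
  have rot' := rot.trans (normEquiv_rotate hn _ _ _ _ _ _)
  by_cases h0 : v 0 ≠ 0 ∨ w 2 ≠ 0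
  · exact key _ _ _ _ _ _ h0
  by_cases h1 : v 1 ≠ 0 ∨ w 0 ≠ 0
  · obtain ⟨p, q, r, a, b, c, hp, h⟩ := key (v 1) (v 2) (v 0) (w 1) (w 2) (w 0) h1
    exact ⟨p, q, r, a, b, c, hp, rot.trans h⟩
  by_cases h3 : v 2 ≠ 0 ∨ w 1 ≠ 0
  · obtain ⟨p, q, r, a, b, c, hp, h⟩ := key (v 2) (v 0) (v 1) (w 2) (w 0) (w 1) h3
    exact ⟨p, q, r, a, b, c, hp, rot'.trans h⟩
  push Not at h0 h1 h3
  refine absurd ?_ hx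
  ext i <;> fin_cases i <;> simp [h0, h1, h3]

/-- With a nonzero first diagonal entry, the rest of the first row and column can be cleared. -/
theorem exists_normEquiv_block (hn : IsOctonionNorm n) (h2 : (2 : F) ≠ 0) {p : F} (hp : p ≠ 0)
    (q r : F) (a b c : C) : ∃ (q' r' : F) (a' : C),
      NormEquiv n ⟨![p, q, r], ![a, b, c]⟩ ⟨![p, q', r'], ![a', 0, 0]⟩ := by
  obtain ⟨q', d, h⟩ := exists_normEquiv_lower hn h2 hp q r a b c
  obtain ⟨r', e, h'⟩ := exists_normEquiv_upper hn h2 hp r q' 0 (a + octConj n b * octConj n d) b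
  rw [octConj_zero, mul_zero, add_zero] at h'
  exact ⟨_, _, _, (((h.trans (normEquiv_rotate hn _ _ _ _ _ _)).trans
    (normEquiv_rotate hn _ _ _ _ _ _)).trans h').trans (normEquiv_rotate hn _ _ _ _ _ _)⟩

/-- The remaining `2 × 2` block can be diagonalized. -/
theorem exists_normEquiv_diagonal (hn : IsOctonionNorm n) (h2 : (2 : F) ≠ 0) (p q r : F) (a : C) :
    ∃ q' r' : F, NormEquiv n ⟨![p, q, r], ![a, 0, 0]⟩ ⟨![p, q', r'], 0⟩ := by
  have hz : (![0, 0, 0] : Fin 3 → C) = 0 := by simp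
  have key (q r : F) (hq : q ≠ 0) :
      ∃ q' r' : F, NormEquiv n ⟨![p, q, r], ![a, 0, 0]⟩ ⟨![p, q', r'], 0⟩ := by
    obtain ⟨r', e, h⟩ := exists_normEquiv_lower hn h2 hq r p 0 0 a
    rw [octConj_zero, zero_mul, add_zero] at h
    have := (((normEquiv_rotate hn p q r a 0 0).trans h).trans
      (normEquiv_rotate hn _ _ _ _ _ _)).trans (normEquiv_rotate hn _ _ _ _ _ _)
    rw [hz] at this
    exact ⟨_, _, this⟩
  by_cases hq : q = 0
  · by_cases hr : r = 0
    · by_cases ha : a = 0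
      · subst ha
        rw [hz]
        exact ⟨_, _, NormEquiv.refl _⟩
      · subst hq hr
        -- a hyperbolic block: adding a multiple of one row makes a diagonal entry nonzero
        obtain ⟨d, hd⟩ := hn.exists_polar_ne_zero ha
        have h := (((normEquiv_rotate hn p 0 0 a 0 0).trans
          (normEquiv_upper hn h2 d 0 0 p 0 0 a)).trans
          (normEquiv_rotate hn _ _ _ _ _ _)).trans (normEquiv_rotate hn _ _ _ _ _ _)
        simp only [octConj_zero, mul_zero, add_zero, zero_add, zero_div, zero_smul] at h
        obtain ⟨q', r', h'⟩ := key (2 * QuadraticMap.polar n d a) 0 (mul_ne_zero h2 hd)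
        exact ⟨q', r', h.trans h'⟩
    · obtain ⟨q', e, h⟩ := exists_normEquiv_upper hn h2 hr q p 0 0 a
      rw [octConj_zero, mul_zero, add_zero] at h
      have := (((normEquiv_rotate hn p q r a 0 0).trans h).trans
        (normEquiv_rotate hn _ _ _ _ _ _)).trans (normEquiv_rotate hn _ _ _ _ _ _)
      rw [hz] at this
      exact ⟨_, _, this⟩
  · exact key q r hq

theorem normEquiv_scale {s t : F} (hs : s ≠ 0) (ht : t ≠ 0) (p q r : F) :
    NormEquiv n (⟨![p, q, r], 0⟩ : Albert F C)
      ⟨![s ^ 2 * p, t ^ 2 * q, (s * t)⁻¹ ^ 2 * r], 0⟩ := by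
  refine ⟨scale ![s, t, (s * t)⁻¹], scale ![s⁻¹, t⁻¹, s * t], isDualPair_scale ?_ ?_, ?_⟩
  · exact mul_inv_cancel₀ (mul_ne_zero hs ht)
  · intro i
    fin_cases i
    · exact mul_inv_cancel₀ hs
    · exact mul_inv_cancel₀ ht
    · exact inv_mul_cancel₀ (mul_ne_zero hs ht)
  · ext i
    · fin_cases i <;> rfl
    · exact smul_zero _

/-- Every nonzero element can be brought to one of the diagonal forms `E 0`, `E 0 + E 1` and
`E 0 + E 1 + c E 2` by a norm-preserving transformation. -/
theorem normEquiv_classification [IsAlgClosed F] (hn : IsOctonionNorm n) (h2 : (2 : F) ≠ 0)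
    (x : Albert F C) : x = 0 ∨ NormEquiv n x ⟨![1, 0, 0], 0⟩ ∨ NormEquiv n x ⟨![1, 1, 0], 0⟩ ∨
      ∃ c, c ≠ 0 ∧ NormEquiv n x ⟨![1, 1, c], 0⟩ := by
  refine or_iff_not_imp_left.mpr fun hx => ?_
  obtain ⟨p, q₀, r₀, a₀, b, c, hp, hx1⟩ := exists_normEquiv_diag_ne_zero hn h2 hx
  obtain ⟨q₁, r₁, a, h1⟩ := exists_normEquiv_block hn h2 hp q₀ r₀ a₀ b c
  obtain ⟨q, r, h3⟩ := exists_normEquiv_diagonal hn h2 p q₁ r₁ a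
  have hd := (hx1.trans h1).trans h3
  have root (p : F) (hp : p ≠ 0) : ∃ s, s ≠ 0 ∧ s ^ 2 * p = 1 := by
    obtain ⟨s, hs⟩ := IsAlgClosed.exists_pow_nat_eq p⁻¹ (n := 2) two_pos
    have hsp : s ^ 2 * p = 1 := by rw [hs, inv_mul_cancel₀ hp]
    refine ⟨s, ?_, hsp⟩
    rintro rfl
    simp at hsp
  have key (p q r : F) (hp : p ≠ 0) (hq : q ≠ 0) :
      ∃ c : F, (r = 0 ↔ c = 0) ∧
        NormEquiv n (⟨![p, q, r], 0⟩ : Albert F C) ⟨![1, 1, c], 0⟩ := by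
    obtain ⟨s, hs, hsp⟩ := root p hp
    obtain ⟨t, ht, htq⟩ := root q hq
    have h := normEquiv_scale (n := n) hs ht p q r
    rw [hsp, htq] at h
    exact ⟨_, by simp [hs, ht], h⟩
  by_cases hq : q = 0
  · by_cases hr : r = 0
    · obtain ⟨s, hs, hsp⟩ := root p hp
      subst hq hr
      have h := normEquiv_scale (n := n) hs one_ne_zero p 0 0
      rw [hsp, mul_zero, mul_zero] at h
      exact Or.inl (hd.trans h)
    · obtain ⟨c, hc, h⟩ := key r p q hr hp
      obtain rfl := hc.mp hq
      have hz : (![0, 0, 0] : Fin 3 → C) = 0 := by simp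
      have hrot := (normEquiv_rotate hn p q r 0 0 0).trans (normEquiv_rotate hn _ _ _ _ _ _)
      rw [hz] at hrot
      exact Or.inr (Or.inl ((hd.trans hrot).trans h))
  · obtain ⟨c, hc, h⟩ := key p q r hp hq
    by_cases hr : r = 0
    · obtain rfl := hc.mp hr
      exact Or.inr (Or.inl (hd.trans h))
    · exact Or.inr (Or.inr ⟨c, mt hc.mpr hr, hd.trans h⟩)

end Reduction

section Rank

theorem N_diagonal (v : Fin 3 → F) : N n (⟨v, 0⟩ : Albert F C) = v 0 * v 1 * v 2 := by
  simp [N]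

theorem adj_diagonal (v : Fin 3 → F) :
    adj n (⟨v, 0⟩ : Albert F C) = ⟨fun i => v (i + 1) * v (i + 2), 0⟩ := by
  ext i <;> simp [adj, octConj_zero]

variable [IsScalarTower F C C] [SMulCommClass F C C]

theorem U_diagonal (h2 : (2 : F) ≠ 0) (v : Fin 3 → F) (y : Albert F C) :
    U n ⟨v, 0⟩ y = ⟨fun i => v i ^ 2 * y.diag i, fun i => (v (i + 1) * v (i + 2)) • y.off i⟩ := by
  have hU (x y : Albert F C) : U n x y = (2 : F) • mul n x (mul n x y) - mul n (mul n x x) y := rfl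
  rw [hU]
  ext i
  · simp only [sub_diag, smul_diag, Pi.sub_apply, Pi.smul_apply, smul_eq_mul, mul, Pi.zero_apply,
      octConj_zero, QuadraticMap.polar_zero_left]
    simp
    ring
  · simp only [sub_off, smul_off, Pi.sub_apply, Pi.smul_apply, mul, Pi.zero_apply,
      octConj_zero, QuadraticMap.polar_zero_left]
    simp [octConj_zero]
    match_scalars
    field_simp
    ring

theorem rank_zero (h2 : (2 : F) ≠ 0) : rank n (0 : Albert F C) = 0 := by
  have h : U n (0 : Albert F C) = 0 := LinearMap.ext fun y => by
    have := U_diagonal (n := n) h2 0 y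
    refine this.trans ?_
    ext i <;> simp
  rw [rank, h, LinearMap.range_zero, finrank_bot]

theorem rank_diagonal_one (h2 : (2 : F) ≠ 0) :
    rank n (⟨![1, 0, 0], 0⟩ : Albert F C) = 1 := by
  have hU (y : Albert F C) : U n ⟨![1, 0, 0], 0⟩ y = y.diag 0 • ⟨![1, 0, 0], 0⟩ := by
    rw [U_diagonal h2]
    ext i <;> fin_cases i <;> simp
  have h : LinearMap.range (U n (⟨![1, 0, 0], 0⟩ : Albert F C))
      = Submodule.span F {⟨![1, 0, 0], 0⟩} := by
    ext z
    rw [LinearMap.mem_range, Submodule.mem_span_singleton]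
    exact ⟨fun ⟨y, hy⟩ => ⟨_, (hU y).symm.trans hy⟩,
      fun ⟨a, ha⟩ => ⟨⟨fun _ => a, 0⟩, (hU _).trans ha⟩⟩
  rw [rank, h, finrank_span_singleton]
  intro h0
  simpa using congrFun (congrArg diag h0) 0

theorem rank_diagonal_two (hn : IsOctonionNorm n) (h2 : (2 : F) ≠ 0) :
    rank n (⟨![1, 1, 0], 0⟩ : Albert F C) = 10 := by
  -- factor `U` through the three entries on which it is not zero
  have := hn.finite
  let π : Albert F C →ₗ[F] F × F × C :=
    { toFun := fun y => (y.diag 0, y.diag 1, y.off 2)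
      map_add' := fun _ _ => rfl
      map_smul' := fun _ _ => rfl }
  let j : F × F × C →ₗ[F] Albert F C :=
    { toFun := fun w => ⟨![w.1, w.2.1, 0], ![0, 0, w.2.2]⟩
      map_add' := fun _ _ => by ext i <;> fin_cases i <;> simp
      map_smul' := fun _ _ => by ext i <;> fin_cases i <;> simp }
  have hj : Function.LeftInverse π j := fun _ => rfl
  have hU : U n ⟨![1, 1, 0], 0⟩ = j ∘ₗ π := LinearMap.ext fun y => by
    rw [U_diagonal h2]
    ext i <;> fin_cases i <;> simp [j, π]
  rw [rank, hU, LinearMap.range_comp_of_range_eq_top _ (LinearMap.range_eq_top.mpr hj.surjective),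
    LinearMap.finrank_range_of_inj hj.injective]
  simp [hn.finrank_eq]

theorem rank_diagonal_three (hn : IsOctonionNorm n) (h2 : (2 : F) ≠ 0) {c : F} (hc : c ≠ 0) :
    rank n (⟨![1, 1, c], 0⟩ : Albert F C) = 27 := by
  have hv (i : Fin 3) : ![1, 1, c] i ≠ 0 := by
    fin_cases i
    exacts [one_ne_zero, one_ne_zero, hc]
  have hs : Function.Surjective (U n (⟨![1, 1, c], 0⟩ : Albert F C)) := fun z => by
    refine ⟨⟨fun i => (![1, 1, c] i ^ 2)⁻¹ * z.diag i,
      fun i => (![1, 1, c] (i + 1) * ![1, 1, c] (i + 2))⁻¹ • z.off i⟩, ?_⟩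
    rw [U_diagonal h2]
    ext i
    · exact mul_inv_cancel_left₀ (pow_ne_zero 2 (hv i)) _
    · exact smul_inv_smul₀ (mul_ne_zero (hv _) (hv _)) _
  rw [rank, LinearMap.range_eq_top.mpr hs, finrank_top, finrank_eq hn]

/-- The orbit representative of an element and its rank are determined by the vanishing of the
element, of its adjoint and of its norm. -/
theorem rank_classification [IsAlgClosed F] (hn : IsOctonionNorm n) (h2 : (2 : F) ≠ 0)
    (x : Albert F C) :
    (x = 0 ∧ adj n x = 0 ∧ N n x = 0 ∧ rank n x = 0) ∨
    (x ≠ 0 ∧ adj n x = 0 ∧ N n x = 0 ∧ rank n x = 1 ∧ NormEquiv n x ⟨![1, 0, 0], 0⟩) ∨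
    (x ≠ 0 ∧ adj n x ≠ 0 ∧ N n x = 0 ∧ rank n x = 10 ∧ NormEquiv n x ⟨![1, 1, 0], 0⟩) ∨
    (x ≠ 0 ∧ N n x ≠ 0 ∧ rank n x = 27 ∧ NormEquiv n x ⟨![1, 1, N n x], 0⟩) := by
  by_cases hx : x = 0
  · subst hx
    exact Or.inl ⟨rfl, by ext i <;> simp [adj, octConj_zero], by simp [N], rank_zero h2⟩
  rcases (normEquiv_classification hn h2 x).resolve_left hx with h | h | ⟨c, hc, h⟩
  · refine Or.inr (Or.inl ⟨hx, ?_, ?_, ?_, h⟩)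
    · rw [← h.adj_eq_zero_iff hn h2, adj_diagonal]
      ext i <;> fin_cases i <;> simp
    · rw [← h.N_eq, N_diagonal]
      simp
    · rw [← h.rank_eq hn h2, rank_diagonal_one h2]
  · refine Or.inr (Or.inr (Or.inl ⟨hx, ?_, ?_, ?_, h⟩))
    · rw [Ne, ← h.adj_eq_zero_iff hn h2, adj_diagonal]
      intro h0
      simpa using congrFun (congrArg diag h0) 2
    · rw [← h.N_eq, N_diagonal]
      simp
    · rw [← h.rank_eq hn h2, rank_diagonal_two hn h2]
  · have hN : N n x = c := by
      rw [← h.N_eq, N_diagonal]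
      simp
    refine Or.inr (Or.inr (Or.inr ⟨hx, hN ▸ hc, ?_, hN ▸ h⟩))
    rw [← h.rank_eq hn h2, rank_diagonal_three hn h2 hc]

end Rank

end Albert

/-! ### Orbits and minimal polynomials -/

namespace Albert

variable {F C : Type*} [Field F] [NonAssocRing C] [Module F C] {n : QuadraticForm F C}

section Orbits

theorem multiplier_ne_zero {f : Albert F C ≃ₗ[F] Albert F C} {c : F}
    (hf : ∀ x, N n (f x) = c * N n x) : c ≠ 0 := by
  rintro rfl
  have h := hf (f.symm 1)
  rw [f.apply_symm_apply, N_one, zero_mul] at h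
  exact one_ne_zero h

variable [IsScalarTower F C C] [SMulCommClass F C C]

/-- A norm similarity preserves the critical points of the norm. -/
theorem adj_apply_eq_zero_iff (hn : IsOctonionNorm n) (h2 : (2 : F) ≠ 0)
    {f : Albert F C ≃ₗ[F] Albert F C} {c : F} (hf : ∀ x, N n (f x) = c * N n x)
    (x : Albert F C) : adj n (f x) = 0 ↔ adj n x = 0 := by
  have key (y : Albert F C) : traceForm n (adj n (f x)) (f y) = c * traceForm n (adj n x) y := by
    refine mul_left_cancel₀ h2 ?_
    have h := two_mul_traceForm_adj hn (f x) (f y)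
    rw [← map_add, ← map_sub, hf, hf, hf] at h
    linear_combination h - c * two_mul_traceForm_adj hn x y
  have hz (y : Albert F C) : traceForm n 0 y = 0 := by simp [traceForm]
  refine ⟨fun h => eq_zero_of_traceForm_eq_zero hn h2 fun y => ?_,
    fun h => eq_zero_of_traceForm_eq_zero hn h2 fun y => ?_⟩
  · have hy := key y
    rw [h, hz] at hy
    exact (mul_eq_zero.mp hy.symm).resolve_left (multiplier_ne_zero hf)
  · have hy := key (f.symm y)
    rwa [f.apply_symm_apply, h, hz, mul_zero] at hy

/-- Norm similarities preserve the rank, since the rank is determined by conditions that are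
visibly invariant under them. -/
theorem rank_apply [IsAlgClosed F] (hn : IsOctonionNorm n) (h2 : (2 : F) ≠ 0)
    {f : Albert F C ≃ₗ[F] Albert F C} {c : F} (hf : ∀ x, N n (f x) = c * N n x)
    (x : Albert F C) : rank n (f x) = rank n x := by
  have h0 : f x = 0 ↔ x = 0 := f.map_eq_zero_iff
  have ha := adj_apply_eq_zero_iff hn h2 hf x
  have hN : N n (f x) = 0 ↔ N n x = 0 := by
    rw [hf, mul_eq_zero, or_iff_right (multiplier_ne_zero hf)]
  have hx := rank_classification hn h2 x
  have hy := rank_classification hn h2 (f x)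
  rw [h0, ne_eq, ha, ne_eq, hN, ne_eq] at hy
  grind

theorem orbit_isometryGroup [IsAlgClosed F] (hn : IsOctonionNorm n) (h2 : (2 : F) ≠ 0)
    (x : Albert F C) : MulAction.orbit (isometryGroup n) x
      = {y | rank n y = rank n x ∧ N n y = N n x} := by
  ext y
  constructor
  · rintro ⟨⟨f, hf⟩, rfl⟩
    exact ⟨rank_apply hn h2 (c := 1) (fun z => (hf z).trans (one_mul _).symm) x, hf x⟩
  · rintro ⟨hr, hN⟩
    have common {e : Albert F C} (hx : NormEquiv n x e) (hy : NormEquiv n y e) :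
        y ∈ MulAction.orbit (isometryGroup n) x := by
      rw [← MulAction.orbit_eq_iff, ← MulAction.orbit_eq_iff.mpr (hx.mem_orbit hn h2),
        ← MulAction.orbit_eq_iff.mpr (hy.mem_orbit hn h2)]
    have hy := rank_classification hn h2 y
    rw [hr, hN] at hy
    rcases rank_classification hn h2 x with h | h | h | h
    · have : y = x := by grind
      rw [this]
      exact MulAction.mem_orbit_self x
    · exact common h.2.2.2.2 (by grind)
    · exact common h.2.2.2.2 (by grind)
    · exact common h.2.2.2 (by grind)

theorem orbit_normSimilarityGroup [IsAlgClosed F] (hn : IsOctonionNorm n) (h2 : (2 : F) ≠ 0)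
    (x : Albert F C) : MulAction.orbit (normSimilarityGroup n) x = rankSet n (rank n x) := by
  ext y
  constructor
  · rintro ⟨⟨f, c, hf⟩, rfl⟩
    exact rank_apply hn h2 hf x
  · intro hr
    change rank n y = rank n x at hr
    -- a scalar `t` with `t ^ 3 * N x = N y`
    have ht : ∃ t : F, t ≠ 0 ∧ N n y = t ^ 3 * N n x := by
      have hx := rank_classification hn h2 x
      have hy := rank_classification hn h2 y
      by_cases hN : N n x = 0
      · exact ⟨1, one_ne_zero, by grind⟩
      · have hN' : N n y ≠ 0 := by grind
        obtain ⟨t, ht⟩ := IsAlgClosed.exists_pow_nat_eq (N n y / N n x) (n := 3) three_pos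
        refine ⟨t, ?_, by rw [ht, div_mul_cancel₀ _ hN]⟩
        rintro rfl
        rw [zero_pow three_ne_zero, eq_comm, div_eq_zero_iff] at ht
        tauto
    obtain ⟨t, ht, hty⟩ := ht
    have hs (z : Albert F C) : N n (LinearEquiv.smulOfNeZero F _ t ht z) = t ^ 3 * N n z := by
      change N n (t • z) = _
      simp only [N, smul_diag, smul_off, Pi.smul_apply, octConj_smul, mul_smul_comm,
        smul_mul_assoc, QuadraticMap.polar_smul_left, QuadraticMap.polar_smul_right,
        QuadraticMap.map_smul, smul_eq_mul, Fin.sum_univ_three]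
      ring
    have hmem : y ∈ MulAction.orbit (isometryGroup n) (LinearEquiv.smulOfNeZero F _ t ht x) := by
      rw [orbit_isometryGroup hn h2]
      exact ⟨by rw [rank_apply hn h2 hs, hr], by rw [hs, hty]⟩
    obtain ⟨⟨f, hf⟩, rfl⟩ := hmem
    exact ⟨⟨f * LinearEquiv.smulOfNeZero F _ t ht, t ^ 3, fun z => (hf _).trans (hs z)⟩, rfl⟩

end Orbits

section MinimalPolynomial

theorem S_eq_T_adj (h2 : (2 : F) ≠ 0) (x : Albert F C) : S n x = T (adj n x) := by
  simp only [S, T, mul, adj, QuadraticMap.polar_self, nsmul_eq_mul, Nat.cast_ofNat,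
    Fin.isValue, Fin.reduceAdd, zero_add]
  field_simp
  ring

theorem mul_one (h2 : (2 : F) ≠ 0) (x : Albert F C) : mul n x 1 = x := by
  ext i
  · simp [mul]
  · simp only [mul, one_off, Pi.zero_apply, octConj_zero, one_diag, smul_zero, mul_zero, zero_mul]
    match_scalars
    field_simp
    norm_num

theorem ne_smul_one {x : Albert F C} (hx : x ≠ 0) (hN : N n x = 0) (c : F) : x ≠ c • 1 := by
  rintro rfl
  have hc : c = 0 := by simpa [N] using hN
  exact hx (by rw [hc, zero_smul])

/-- A nonscalar element and the identity are linearly independent. -/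
theorem coeff_eq_zero {x : Albert F C} (hx : ∀ c : F, x ≠ c • 1) {a b : F}
    (h : a • x + b • (1 : Albert F C) = 0) : a = 0 ∧ b = 0 := by
  have ha : a = 0 := by
    by_contra ha
    refine hx (-(a⁻¹ * b)) ?_
    have h' := congrArg (a⁻¹ • ·) h
    simp only [smul_add, smul_smul, inv_mul_cancel₀ ha, one_smul, smul_zero] at h'
    rw [neg_smul, eq_neg_of_add_eq_zero_left h']
  refine ⟨ha, ?_⟩
  rw [ha, zero_smul, zero_add] at h
  simpa using congrFun (congrArg diag h) 0

variable [IsScalarTower F C C] [SMulCommClass F C C]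

theorem evalPoly_quadratic (h2 : (2 : F) ≠ 0) (x : Albert F C) (u v : F) :
    evalPoly n x (X ^ 2 + Polynomial.C u * X + Polynomial.C v) = mul n x x + u • x + v • 1 := by
  have h1 : L n x 1 = x := mul_one h2 x
  have h3 : L n x x = mul n x x := rfl
  simp [evalPoly, pow_two, h1, h3]

theorem evalPoly_minPoly (x : Albert F C) : evalPoly n x (minPoly n x) = 0 :=
  Ideal.mul_mem_right _ (annIdeal n x) (Submodule.IsPrincipal.generator_mem _)

theorem monic_minPoly {x : Albert F C} (h : minPoly n x ≠ 0) : (minPoly n x).Monic :=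
  monic_mul_leadingCoeff_inv (left_ne_zero_of_mul h)

theorem minPoly_dvd {x : Albert F C} {p : F[X]} (hp : evalPoly n x p = 0) : minPoly n x ∣ p := by
  have h : Submodule.IsPrincipal.generator (annIdeal n x) ∣ p :=
    (Submodule.IsPrincipal.mem_iff_generator_dvd _).mp hp
  by_cases h0 : Submodule.IsPrincipal.generator (annIdeal n x) = 0
  · rw [h0, zero_dvd_iff] at h
    rw [h]
    exact dvd_zero _
  · refine (IsUnit.mul_right_dvd ?_).mpr h
    exact isUnit_C.mpr (isUnit_iff_ne_zero.mpr (inv_ne_zero (leadingCoeff_ne_zero.mpr h0)))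

/-- A quadratic polynomial that vanishes at a nonscalar element is its minimal polynomial. -/
theorem minPoly_eq_quadratic (h2 : (2 : F) ≠ 0) {x : Albert F C} (hx : ∀ c : F, x ≠ c • 1)
    {u v : F} (h : mul n x x + u • x + v • 1 = 0) :
    minPoly n x = X ^ 2 + Polynomial.C u * X + Polynomial.C v := by
  have hp : (X ^ 2 + Polynomial.C u * X + Polynomial.C v).Monic := by monicity!
  have hd : (X ^ 2 + Polynomial.C u * X + Polynomial.C v).natDegree = 2 := by compute_degree!
  have hdvd : minPoly n x ∣ X ^ 2 + Polynomial.C u * X + Polynomial.C v :=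
    minPoly_dvd (by rw [evalPoly_quadratic h2, h])
  have hm := monic_minPoly (ne_zero_of_dvd_ne_zero hp.ne_zero hdvd)
  refine (eq_of_monic_of_dvd_of_natDegree_le hm hp hdvd ?_).symm
  rw [hd]
  by_contra! hlt
  have he := evalPoly_minPoly (n := n) x
  obtain h0 | h1 : (minPoly n x).natDegree = 0 ∨ (minPoly n x).natDegree = 1 := by omega
  · rw [hm.natDegree_eq_zero.mp h0] at he
    replace he : (1 : Albert F C) = 0 := by
      rwa [evalPoly, map_one (aeval (L n x)), Module.End.one_apply] at he
    simpa using congrFun (congrArg diag he) 0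
  · rw [hm.eq_X_add_C h1, evalPoly, map_add, aeval_X, aeval_C, LinearMap.add_apply] at he
    have h3 : L n x 1 = x := mul_one h2 x
    rw [h3, Module.algebraMap_end_apply] at he
    exact one_ne_zero (coeff_eq_zero hx (a := 1) ((congrArg (· + _) (one_smul F x)).trans he)).1

theorem minPoly_eq_of_adj_eq_zero (h2 : (2 : F) ≠ 0) {x : Albert F C} (hx : x ≠ 0)
    (hN : N n x = 0) (ha : adj n x = 0) :
    minPoly n x = X ^ 2 - Polynomial.C (T x) * X := by
  have hS : S n x = 0 := by
    rw [S_eq_T_adj h2, ha]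
    simp [T]
  have h := mul_self_eq n h2 x
  rw [ha, hS] at h
  rw [minPoly_eq_quadratic h2 (ne_smul_one hx hN) (u := -T x) (v := 0) (by rw [h]; module)]
  simp [sub_eq_add_neg]

/-- If the minimal polynomial of `x` is quadratic, `x² + u x + v = 0`, then the adjoint is
a linear combination of `x` and `1`, and `x ∘ adj x = 0` forces its coefficients to vanish. -/
theorem adj_eq_zero_of_natDegree_minPoly (hn : IsOctonionNorm n) (h2 : (2 : F) ≠ 0)
    {x : Albert F C} (hx : x ≠ 0) (hN : N n x = 0) (hS : S n x = 0)
    (hd : (minPoly n x).natDegree = 2) : adj n x = 0 := by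
  have hm := monic_minPoly (ne_zero_of_natDegree_gt (n := 1) (by rw [hd]; norm_num))
  obtain ⟨u, v, hq⟩ : ∃ u v, minPoly n x = X ^ 2 + Polynomial.C u * X + Polynomial.C v := by
    refine ⟨(minPoly n x).coeff 1, (minPoly n x).coeff 0, ?_⟩
    have h := hm.as_sum
    rw [hd, Finset.sum_range_succ, Finset.sum_range_one, pow_zero, pow_one, _root_.mul_one] at h
    rw [add_assoc, add_comm (Polynomial.C _ * X)]
    exact h
  have he := evalPoly_minPoly (n := n) x
  rw [hq, evalPoly_quadratic h2] at he
  have hsq : mul n x x = (-u) • x + (-v) • 1 := by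
    linear_combination (norm := module) he
  have ha : adj n x = (-(u + T x)) • x + (-v) • 1 := by
    have h := mul_self_eq n h2 x
    rw [hS, hsq] at h
    linear_combination (norm := module) -h
  have hcub : L n x (adj n x) = 0 := by
    have h := mul_adj hn h2 x
    rw [hN, zero_smul] at h
    exact h
  have h1 : L n x 1 = x := mul_one h2 x
  have h3 : L n x x = (-u) • x + (-v) • 1 := hsq
  rw [ha, map_add, map_smul, map_smul, h1, h3] at hcub
  obtain ⟨e1, e2⟩ := coeff_eq_zero (ne_smul_one hx hN)
    (a := (u + T x) * u - v) (b := (u + T x) * v)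
    (by linear_combination (norm := module) hcub)
  have hv : v = 0 := by
    rcases mul_eq_zero.mp e2 with h | h
    · rw [h] at e1
      linear_combination -e1
    · exact h
  have hu : u + T x = 0 := by
    by_contra hu
    have hu0 : u = 0 := by
      rw [hv, sub_zero] at e1
      exact (mul_eq_zero.mp e1).resolve_left hu
    -- now `x² = 0`, so that `S x = 0` gives `T x = 0`
    rw [S, hsq, hu0, hv, neg_zero, zero_smul, zero_smul, add_zero] at hS
    refine hu ?_
    rw [hu0, zero_add]
    simpa [T, h2] using hS
  rw [ha, hu, hv, neg_zero, zero_smul, zero_smul, add_zero]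

end MinimalPolynomial

end Albert

theorem mainTheorem4 {F C : Type*} [Field F] [IsAlgClosed F] (h2 : (2 : F) ≠ 0)
    [NonAssocRing C] [Module F C] [IsScalarTower F C C] [SMulCommClass F C C]
    (n : QuadraticForm F C) (hn : IsOctonionNorm n) :
    (Set.range fun x : Albert F C => MulAction.orbit (Albert.normSimilarityGroup n) x) =
        {Albert.rankSet n 0, Albert.rankSet n 1, Albert.rankSet n 10, Albert.rankSet n 27} ∧
    Albert.rankSet n 0 = {0} ∧
    Albert.rankSet n 27 = {x | Albert.N n x ≠ 0} ∧
    Albert.rankSet n 1 = {x | x ≠ 0 ∧ Albert.N n x = 0 ∧ Albert.S n x = 0 ∧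
        (Albert.minPoly n x).natDegree = 2} ∧
    (∀ x ∈ Albert.rankSet n 1,
        Albert.minPoly n x = X ^ 2 - Polynomial.C (Albert.T x) * X) ∧
    (Set.range fun x : Albert F C => MulAction.orbit (Albert.isometryGroup n) x) =
        {Albert.rankSet n 0, Albert.rankSet n 1, Albert.rankSet n 10} ∪
          Set.range fun c : Fˣ => {x | x ∈ Albert.rankSet n 27 ∧ Albert.N n x = (c : F)} := by
  have cls := Albert.rank_classification hn h2
  have hz : Albert.rank n (0 : Albert F C) = 0 := Albert.rank_zero h2
  have h1 := Albert.rank_diagonal_one (n := n) h2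
  have h10 := Albert.rank_diagonal_two hn h2
  have h27 {c : F} (hc : c ≠ 0) := Albert.rank_diagonal_three hn h2 hc
  have hN1 (c : F) : Albert.N n ⟨![1, 1, c], 0⟩ = c := by
    rw [Albert.N_diagonal]
    simp
  have hN (x : Albert F C) : x ∈ Albert.rankSet n 27 ↔ Albert.N n x ≠ 0 := by
    have := cls x
    change Albert.rank n x = 27 ↔ _
    grind
  have hset (x : Albert F C) : x ∈ Albert.rankSet n 1 ↔
      x ≠ 0 ∧ Albert.N n x = 0 ∧ Albert.adj n x = 0 := by
    have := cls x
    change Albert.rank n x = 1 ↔ _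
    grind
  refine ⟨?_, ?_, ?_, ?_, ?_, ?_⟩
  · simp only [Albert.orbit_normSimilarityGroup hn h2]
    ext s
    simp only [Set.mem_range, Set.mem_insert_iff, Set.mem_singleton_iff]
    constructor
    · rintro ⟨x, rfl⟩
      rcases cls x with h | h | h | h
      · rw [h.2.2.2]; simp
      · rw [h.2.2.2.1]; simp
      · rw [h.2.2.2.1]; simp
      · rw [h.2.2.1]; simp
    · rintro (rfl | rfl | rfl | rfl)
      · exact ⟨0, by rw [hz]⟩
      · exact ⟨_, by rw [h1]⟩
      · exact ⟨_, by rw [h10]⟩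
      · exact ⟨_, by rw [h27 one_ne_zero]⟩
  · ext x
    have := cls x
    change Albert.rank n x = 0 ↔ x = 0
    grind
  · ext x
    exact hN x
  · ext x
    rw [hset]
    constructor
    · rintro ⟨hx, hN0, ha⟩
      refine ⟨hx, hN0, ?_, ?_⟩
      · rw [Albert.S_eq_T_adj h2, ha]
        simp [Albert.T]
      · rw [Albert.minPoly_eq_of_adj_eq_zero h2 hx hN0 ha]
        compute_degree!
    · rintro ⟨hx, hN0, hS, hd⟩
      exact ⟨hx, hN0, Albert.adj_eq_zero_of_natDegree_minPoly hn h2 hx hN0 hS hd⟩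
  · intro x hx
    obtain ⟨hx0, hN0, ha⟩ := (hset x).mp hx
    exact Albert.minPoly_eq_of_adj_eq_zero h2 hx0 hN0 ha
  · simp only [Albert.orbit_isometryGroup hn h2]
    have hlow {x : Albert F C} {k : ℕ} (hk : k ≠ 27) (hx : Albert.rank n x = k) :
        {y | Albert.rank n y = Albert.rank n x ∧ Albert.N n y = Albert.N n x}
          = Albert.rankSet n k := by
      have hzero (y : Albert F C) (hy : Albert.rank n y = k) : Albert.N n y = 0 := by
        by_contra h
        exact hk (hy.symm.trans ((hN y).mpr h))
      ext y
      exact ⟨fun h => h.1.trans hx,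
        fun h => ⟨Eq.trans h hx.symm, (hzero y h).trans (hzero x hx).symm⟩⟩
    ext s
    simp only [Set.mem_range, Set.mem_union, Set.mem_insert_iff, Set.mem_singleton_iff]
    constructor
    · rintro ⟨x, rfl⟩
      rcases cls x with h | h | h | h
      · exact Or.inl (Or.inl (hlow (by norm_num) h.2.2.2))
      · exact Or.inl (Or.inr (Or.inl (hlow (by norm_num) h.2.2.2.1)))
      · exact Or.inl (Or.inr (Or.inr (hlow (by norm_num) h.2.2.2.1)))
      · obtain ⟨-, hx, hr, -⟩ := h
        refine Or.inr ⟨Units.mk0 _ hx, ?_⟩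
        simp only [hr]
        rfl
    · rintro ((rfl | rfl | rfl) | ⟨c, rfl⟩)
      · exact ⟨0, hlow (by norm_num) hz⟩
      · exact ⟨_, hlow (by norm_num) h1⟩
      · exact ⟨_, hlow (by norm_num) h10⟩
      · refine ⟨⟨![1, 1, c], 0⟩, ?_⟩
        rw [h27 c.ne_zero, hN1]
        rfl
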